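/- **Corollary 3.11.** By a $d$-plane in $\mathbb{R}^m$ we mean a $d$-dimensional affine subspace of $\mathbb{R}^m$; the empty set is the only plane of dimension $-1$. Two planes $\Pi,\Pi'\subset\mathbb{R}^m$ are called *skew* if the affine hull of $\Pi\cup\Pi'$ has dimension $\dim\Pi+\dim\Pi'+1$. Let $M_{m,d}$ denote the space of all $d$-planes in $\mathbb{R}^m$ with its usual (metrizable) topology: writing each nonempty plane uniquely as $v+V$ with $V$ a linear subspace and $v\perp V$, and letting $p_V$ be the orthogonal projection onto $V$, it is given by the metric $\rho(v+V,v'+V')=\|p_V-p_{V'}\|+\|v-v'\|$ (for $d=-1$ it is a single point). Let $\Pi_1,\Pi_2,\Pi_3\subset\mathbb{R}^m$ be planes of dimensions $n_1,n_2,n_3$, any two of which are skew, and suppose that the affine hull of $\Pi_1\cup\Pi_2\cup\Pi_3$ is $\mathbb{R}^m$. Let $r\ge -1$ be an integer with $m\le n_1+n_2+n_3+1-r$. Then the subspace $$\{\Pi\in M_{m,2r+1} : \dim(\Pi\cap\Pi_i)\ge r,\ i=1,2,3\}$$ of $M_{m,2r+1}$ has covering dimension at most $(n_1+n_2+n_3+1-m-r)(r+1)$.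 Here a space $X$ has covering dimension at most $d$, where $d\ge -1$ is an integer, if every open cover of $X$ has an open refinement covering $X$ such that each point of $X$ lies in at most $d+1$ of its members. -/

import Mathlib

/-- The dimension of an affine subspace of `ℝ^m`, as an integer; the empty one has dimension `-1`. -/
noncomputable def planeDim {m : ℕ} (P : AffineSubspace ℝ (EuclideanSpace ℝ (Fin m))) : ℤ :=
  open Classical in if P = ⊥ then -1 else (Module.finrank ℝ P.direction : ℤ)

/-- The set of all `d`-planes (affine `d`-dimensional subspaces) of `ℝ^m`. -/
def PlaneSpace (m : ℕ) (d : ℤ) : Type :=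
  {P : AffineSubspace ℝ (EuclideanSpace ℝ (Fin m)) // planeDim P = d}

/-- The point of an affine subspace nearest to the origin (by convention the origin itself for
the empty subspace). -/
noncomputable def planeFoot {m : ℕ} (P : AffineSubspace ℝ (EuclideanSpace ℝ (Fin m))) :
    EuclideanSpace ℝ (Fin m) :=
  open Classical in
  if h : Nonempty P then
    haveI := h
    (EuclideanGeometry.orthogonalProjection P (0 : EuclideanSpace ℝ (Fin m)) :
      EuclideanSpace ℝ (Fin m))
  else 0

/-- A plane is `v + V` for exactly one linear subspace `V` and one vector `v` orthogonal to `V`.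
It is recorded here as the orthogonal projection of `ℝ^m` onto `V` together with `v`. -/
noncomputable def planeCoord {m : ℕ} {d : ℤ} (P : PlaneSpace m d) :
    (EuclideanSpace ℝ (Fin m) →L[ℝ] EuclideanSpace ℝ (Fin m)) × EuclideanSpace ℝ (Fin m) :=
  (P.1.direction.starProjection, planeFoot P.1)

/-- The usual topology of the space of `d`-planes (the affine Grassmannian), that is, the topology
of the metric `‖p_V - p_{V'}‖ + ‖v - v'‖`, where `p_V` is the orthogonal projection onto `V`, for
planes `v + V` and `v' + V'` written with `v ⊥ V` and `v' ⊥ V'`. -/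
noncomputable instance PlaneSpace.instTopologicalSpace (m : ℕ) (d : ℤ) :
    TopologicalSpace (PlaneSpace m d) :=
  TopologicalSpace.induced planeCoord inferInstance

/-- Two planes are skew if the affine hull of their union has the largest possible dimension,
`dim P + dim Q + 1`. -/
def Skew {m : ℕ} (P Q : AffineSubspace ℝ (EuclideanSpace ℝ (Fin m))) : Prop :=
  planeDim (affineSpan ℝ ((P : Set (EuclideanSpace ℝ (Fin m))) ∪ Q)) = planeDim P + planeDim Q + 1

/-- `dim X ≤ d` for the (Lebesgue) covering dimension: every open cover `U` of `X` has an open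
refinement `V` covering `X` such that each point lies in at most `d + 1` members of `V`. The clause
`-1 ≤ d` gives the empty space dimension `-1`. -/
def CoveringDimLE (X : Type*) [TopologicalSpace X] (d : ℤ) : Prop :=
  -1 ≤ d ∧
    ∀ U : Set (Set X), (∀ u ∈ U, IsOpen u) → ⋃₀ U = Set.univ →
      ∃ V : Set (Set X), (∀ v ∈ V, IsOpen v) ∧ ⋃₀ V = Set.univ ∧ (∀ v ∈ V, ∃ u ∈ U, v ⊆ u) ∧
        ∀ x : X, {v ∈ V | x ∈ v}.Finite ∧ ({v ∈ V | x ∈ v}.ncard : ℤ) ≤ d + 1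

/-! Placing `ℝ^m` at height `1` in `ℝ^m × ℝ` turns planes into linear subspaces of one dimension
more (`cone`). Write `W i` for the cone of the `i`-th given plane, `s = r + 1`, and `K = (W 1 + W 2)
∩ W 3`. Skewness makes the `W i` pairwise disjoint, and `dim K = n₁ + n₂ + n₃ + 2 - m`. The cone `U`
of an admissible plane has dimension `2s` and meets each `W i` in dimension at least `s`. Hence `U =
(U ∩ W 1) ⊕ (U ∩ W 2)`, while `L = U ∩ W 3` is an `s`-dimensional subspace of `K`. The components of
`L` in `W 1` and `W 2` span `U` (`exists_span_splitVectors_eq`), so `U` is parametrized by the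
Grassmannian of `s`-planes in `K`, whose dimension `s (dim K - s)` is the bound. Matrix charts,
finitely many, cover this Grassmannian. They only have to be continuous and injective: restricted to
compact sets they are closed embeddings, and the countable closed sum theorem does the rest
(`hasZeroDimDecomposition_of_charts`). Dimension is controlled by decomposing a space into `n + 1`
zero-dimensional pieces, which bounds the covering dimension by `n`
(`HasZeroDimDecomposition.coveringDimLE`). -/

open Set Topology

/-! ### Zero-dimensional spaces and their countable sum theorem -/

/-- A space in which every point has a neighbourhood basis of clopen sets. -/
def HasClopenBasis (X : Type*) [TopologicalSpace X] : Prop :=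
  ∀ (x : X) (U : Set X), IsOpen U → x ∈ U → ∃ C, IsClopen C ∧ x ∈ C ∧ C ⊆ U

theorem HasClopenBasis.of_isInducing {X Y : Type*} [TopologicalSpace X] [TopologicalSpace Y]
    {f : X → Y} (hf : IsInducing f) (h : HasClopenBasis Y) : HasClopenBasis X := by
  intro x U hU hx
  obtain ⟨V, hV, rfl⟩ := hf.isOpen_iff.1 hU
  obtain ⟨C, hC, hxC, hCV⟩ := h (f x) V hV hx
  exact ⟨f ⁻¹' C, hC.preimage hf.continuous, hxC, preimage_mono hCV⟩

/-- Every open cover of a second countable space with a clopen basis has a disjoint clopen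
refinement, given here as the fibres of a locally constant map to the index type. -/
theorem HasClopenBasis.exists_isLocallyConstant {X ι : Type*} [TopologicalSpace X]
    [SecondCountableTopology X] (h : HasClopenBasis X) (U : ι → Set X)
    (hU : ∀ i, IsOpen (U i)) (hcov : ∀ x, ∃ i, x ∈ U i) :
    ∃ f : X → ι, IsLocallyConstant f ∧ ∀ x, x ∈ U (f x) := by
  classical
  choose i hi using hcov
  choose C hC hxC hCU using fun x => h x (U (i x)) (hU _) (hi x)
  obtain ⟨S, hS, hSU⟩ := TopologicalSpace.countable_cover_nhds
    fun x => (hC x).isOpen.mem_nhds (hxC x)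
  rcases isEmpty_or_nonempty X with hX | hX
  · exact ⟨fun x => hX.elim x, IsLocallyConstant.of_constant _ fun x => hX.elim x,
      fun x => hX.elim x⟩
  have hne : S.Nonempty := by
    by_contra hn
    obtain ⟨x⟩ := hX
    have hx : x ∈ ⋃ y ∈ S, C y := hSU ▸ mem_univ x
    simp [not_nonempty_iff_eq_empty.1 hn] at hx
  obtain ⟨s, rfl⟩ := hS.exists_eq_range hne
  have hs : ∀ x, ∃ n, x ∈ C (s n) := fun x => by
    have hx : x ∈ ⋃ y ∈ range s, C y := hSU ▸ mem_univ x
    simpa using hx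
  have hN : IsLocallyConstant fun x => Nat.find (hs x) := by
    rw [IsLocallyConstant.iff_isOpen_fiber]
    intro n
    have : (fun x => Nat.find (hs x)) ⁻¹' {n} = C (s n) ∩ ⋂ m ∈ Finset.range n, (C (s m))ᶜ := by
      ext x
      simp [Nat.find_eq_iff]
    rw [this]
    exact (hC _).isOpen.inter (isOpen_biInter_finset fun m _ => (hC _).compl.isOpen)
  exact ⟨fun x => i (s (Nat.find (hs x))), hN.comp fun n => i (s n),
    fun x => hCU _ (Nat.find_spec (hs x))⟩

theorem HasClopenBasis.exists_isClopen_of_disjoint {X : Type*} [TopologicalSpace X]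
    [SecondCountableTopology X] (h : HasClopenBasis X) {A B : Set X} (hA : IsClosed A)
    (hB : IsClosed B) (hAB : Disjoint A B) : ∃ C, IsClopen C ∧ A ⊆ C ∧ Disjoint C B := by
  obtain ⟨f, hf, hfU⟩ := h.exists_isLocallyConstant (fun b : Bool => if b then Bᶜ else Aᶜ)
    (by rintro (_ | _) <;> simp [hA.isOpen_compl, hB.isOpen_compl]) (by
      intro x
      by_cases hx : x ∈ A
      · exact ⟨true, by simpa using hAB.notMem_of_mem_left hx⟩
      · exact ⟨false, by simpa using hx⟩)
  refine ⟨f ⁻¹' {true}, hf.isClopen_fiber _, fun x hx => ?_, disjoint_left.2 fun x hx => ?_⟩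
  · by_contra hn
    have := hfU x
    simp_all
  · have := hfU x
    simp_all

/-- A clopen subset of `F` separates the traces of `A` and `B`. Adding it to `A` and its complement
in `F` to `B` keeps the sets closed and disjoint, and normality fattens them. Disjoint closures
allow the step to be iterated. -/
theorem exists_isOpen_disjoint_closure_of_hasClopenBasis {X : Type*} [TopologicalSpace X]
    [NormalSpace X] [SecondCountableTopology X] {F A B : Set X} (hF : IsClosed F)
    (h : HasClopenBasis F) (hA : IsClosed A) (hB : IsClosed B) (hAB : Disjoint A B) :
    ∃ A' B' : Set X, IsOpen A' ∧ IsOpen B' ∧ A ⊆ A' ∧ B ⊆ B' ∧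
      Disjoint (closure A') (closure B') ∧ F ⊆ A' ∪ B' := by
  obtain ⟨C, hC, hAC, hCB⟩ := h.exists_isClopen_of_disjoint
    (hA.preimage continuous_subtype_val) (hB.preimage continuous_subtype_val)
    (hAB.preimage Subtype.val)
  have hA1 : IsClosed (A ∪ Subtype.val '' C) :=
    hA.union (hF.isClosedMap_subtype_val _ hC.isClosed)
  have hB1 : IsClosed (B ∪ Subtype.val '' Cᶜ) :=
    hB.union (hF.isClosedMap_subtype_val _ hC.compl.isClosed)
  have hd : A ∪ Subtype.val '' C ⊆ (B ∪ Subtype.val '' Cᶜ)ᶜ := by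
    rintro x (hx | ⟨y, hy, rfl⟩) (hx' | ⟨z, hz, hzx⟩)
    · exact disjoint_left.1 hAB hx hx'
    · subst hzx
      exact hz (hAC hx)
    · exact disjoint_left.1 hCB hy hx'
    · exact hz (Subtype.ext hzx ▸ hy)
  obtain ⟨A', hA', hAA', hA'B⟩ := normal_exists_closure_subset hA1 hB1.isOpen_compl hd
  obtain ⟨B', hB', hBB', hB'A⟩ := normal_exists_closure_subset hB1
    isClosed_closure.isOpen_compl (subset_compl_comm.1 hA'B)
  refine ⟨A', B', hA', hB', subset_union_left.trans hAA', subset_union_left.trans hBB',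
    (disjoint_left.2 fun x hx hx' => hB'A hx' hx), fun x hx => ?_⟩
  by_cases hxC : (⟨x, hx⟩ : F) ∈ C
  · exact Or.inl (hAA' (Or.inr ⟨_, hxC, rfl⟩))
  · exact Or.inr (hBB' (Or.inr ⟨_, hxC, rfl⟩))

/-- The countable sum theorem in dimension zero. -/
theorem HasClopenBasis.of_iUnion_isClosed {X κ : Type*} [TopologicalSpace X] [T4Space X]
    [SecondCountableTopology X] [Countable κ] (F : κ → Set X) (hF : ∀ k, IsClosed (F k))
    (h : ∀ k, HasClopenBasis (F k)) (hcov : ∀ x, ∃ k, x ∈ F k) : HasClopenBasis X := by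
  intro x U hU hx
  have : Nonempty κ := ⟨(hcov x).choose⟩
  obtain ⟨e, he⟩ := exists_surjective_nat κ
  let S := {p : Set X × Set X // Disjoint (closure p.1) (closure p.2)}
  have hstep : ∀ (n : ℕ) (p : S), ∃ q : S, IsOpen q.1.1 ∧ IsOpen q.1.2 ∧ p.1.1 ⊆ q.1.1 ∧
      p.1.2 ⊆ q.1.2 ∧ F (e n) ⊆ q.1.1 ∪ q.1.2 := fun n p => by
    obtain ⟨A', B', h1, h2, h3, h4, h5, h6⟩ :=
      exists_isOpen_disjoint_closure_of_hasClopenBasis (hF (e n)) (h (e n))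
        isClosed_closure isClosed_closure p.2
    exact ⟨⟨(A', B'), h5⟩, h1, h2, subset_closure.trans h3, subset_closure.trans h4, h6⟩
  choose q hq1 hq2 hq3 hq4 hq5 using hstep
  have h0 : Disjoint (closure {x}) (closure Uᶜ) := by
    rw [closure_singleton, hU.isClosed_compl.closure_eq]
    simpa using hx
  -- Stage `n + 1` distributes `F (e n)` between two growing sets. In the limit they are open and
  -- complementary.
  let s : ℕ → S := fun n => Nat.rec ⟨({x}, Uᶜ), h0⟩ q n
  have hs : ∀ n, s (n + 1) = q n (s n) := fun n => rfl
  have hm1 : Monotone fun n => (s n).1.1 := monotone_nat_of_le_succ fun n => hs n ▸ hq3 n (s n)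
  have hm2 : Monotone fun n => (s n).1.2 := monotone_nat_of_le_succ fun n => hs n ▸ hq4 n (s n)
  have hdisj : ∀ a b y, y ∈ (s a).1.1 → y ∈ (s b).1.2 → False := fun a b y ha hb =>
    disjoint_left.1 (s (max a b)).2 (subset_closure (hm1 (le_max_left a b) ha))
      (subset_closure (hm2 (le_max_right a b) hb))
  -- The shift by one skips `{x}` and `Uᶜ`, which need not be open.
  have hcompl : (⋃ n, (s (n + 1)).1.1)ᶜ = ⋃ n, (s (n + 1)).1.2 := by
    ext y
    simp only [mem_compl_iff, mem_iUnion, not_exists]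
    constructor
    · intro hy
      obtain ⟨k, hk⟩ := hcov y
      obtain ⟨n, rfl⟩ := he k
      exact ⟨n, (hq5 n (s n) hk).resolve_left (hy n)⟩
    · rintro ⟨n, hn⟩ k hk
      exact hdisj (k + 1) (n + 1) y hk hn
  refine ⟨⋃ n, (s (n + 1)).1.1, ⟨?_, isOpen_iUnion fun n => hq1 n (s n)⟩,
    mem_iUnion.2 ⟨0, hm1 (Nat.zero_le 1) (mem_singleton x)⟩, fun y hy => ?_⟩
  · rw [← isOpen_compl_iff, hcompl]
    exact isOpen_iUnion fun n => hq2 n (s n)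
  · obtain ⟨n, hn⟩ := mem_iUnion.1 hy
    by_contra hyU
    exact hdisj (n + 1) 0 y hn hyU

/-! ### Decompositions into zero-dimensional pieces and covering dimension -/

/-- `X` is the union of `n + 1` subspaces each having a clopen basis. -/
def HasZeroDimDecomposition (X : Type*) [TopologicalSpace X] (n : ℕ) : Prop :=
  ∃ Z : Fin (n + 1) → Set X, (∀ x, ∃ j, x ∈ Z j) ∧ ∀ j, HasClopenBasis (Z j)

theorem HasZeroDimDecomposition.of_isInducing {X Y : Type*} [TopologicalSpace X]
    [TopologicalSpace Y] {n : ℕ} {f : X → Y} (hf : IsInducing f)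
    (h : HasZeroDimDecomposition Y n) : HasZeroDimDecomposition X n := by
  obtain ⟨Z, hZ, hZb⟩ := h
  refine ⟨fun j => f ⁻¹' Z j, fun x => hZ (f x), fun j => (hZb j).of_isInducing
    (f := (mapsTo_preimage f (Z j)).restrict) ?_⟩
  have : IsInducing (Subtype.val ∘ (mapsTo_preimage f (Z j)).restrict) :=
    hf.comp IsInducing.subtypeVal
  exact IsInducing.of_comp ((hf.continuous.restrict _)) continuous_subtype_val this

/-- Each point uses the decomposition of the first closed set that contains it. The points with
first index `l` form an Fσ set, since open sets of a metrizable space are Fσ. So each new piece is a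
countable union of relatively closed sets lying in old pieces, and the zero-dimensional sum theorem
applies. -/
theorem HasZeroDimDecomposition.of_iUnion_isClosed {X κ : Type*} [TopologicalSpace X]
    [TopologicalSpace.MetrizableSpace X] [SecondCountableTopology X] [Countable κ] {n : ℕ}
    (F : κ → Set X) (hF : ∀ k, IsClosed (F k)) (h : ∀ k, HasZeroDimDecomposition (F k) n)
    (hcov : ∀ x, ∃ k, x ∈ F k) : HasZeroDimDecomposition X n := by
  classical
  let := TopologicalSpace.metrizableSpaceMetric X
  rcases isEmpty_or_nonempty κ with hκ | hκ
  · exact ⟨fun _ => ∅, fun x => hκ.elim (hcov x).choose, fun _ x => x.2.elim⟩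
  obtain ⟨e, he⟩ := exists_surjective_nat κ
  have hcov' : ∀ x, ∃ l, x ∈ F (e l) := fun x => by
    obtain ⟨k, hk⟩ := hcov x
    obtain ⟨l, rfl⟩ := he k
    exact ⟨l, hk⟩
  choose Z hZ hZb using h
  let N : X → ℕ := fun x => Nat.find (hcov' x)
  have hN : ∀ x, x ∈ F (e (N x)) := fun x => Nat.find_spec (hcov' x)
  have hopen : ∀ l, ∃ G : ℕ → Set X, (∀ i, IsClosed (G i)) ∧
      ⋃ i, G i = ⋂ m ∈ Finset.range l, (F (e m))ᶜ := fun l => by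
    obtain ⟨G, hG, -, hGu, -⟩ := (isOpen_biInter_finset (s := Finset.range l)
      fun m _ => (hF (e m)).isOpen_compl).exists_iUnion_isClosed
    exact ⟨G, hG, hGu⟩
  choose G hG hGu using hopen
  have hGmem : ∀ l x, (∃ i, x ∈ G l i) ↔ ∀ m < l, x ∉ F (e m) := fun l x => by
    rw [← mem_iUnion, hGu]
    simp
  have hNeq : ∀ l i x, x ∈ F (e l) → x ∈ G l i → N x = l := fun l i x hx hxG =>
    (Nat.find_eq_iff _).2 ⟨hx, fun m hm => (hGmem l x).1 ⟨i, hxG⟩ m hm⟩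
  refine ⟨fun j => {x | x ∈ (Subtype.val '' Z (e (N x)) j : Set X)}, fun x => ?_, fun j => ?_⟩
  · obtain ⟨j, hj⟩ := hZ _ ⟨x, hN x⟩
    exact ⟨j, _, hj, rfl⟩
  refine HasClopenBasis.of_iUnion_isClosed
    (fun p : ℕ × ℕ => Subtype.val ⁻¹' (F (e p.1) ∩ G p.1 p.2))
    (fun p => ((hF _).inter (hG _ _)).preimage continuous_subtype_val) (fun p => ?_) fun x => ?_
  · obtain ⟨l, i⟩ := p
    have hx : ∀ x : ((Subtype.val ⁻¹' (F (e l) ∩ G l i) :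
        Set {x | x ∈ (Subtype.val '' Z (e (N x)) j : Set X)})), ∃ y : Z (e l) j,
        (y.1.1 : X) = x.1.1 := fun x => by
      have hx : x.1.1 ∈ (Subtype.val '' Z (e (N x.1.1)) j : Set X) := x.1.2
      rw [hNeq l i x.1.1 x.2.1 x.2.2] at hx
      obtain ⟨y, hy, hyx⟩ := hx
      exact ⟨⟨y, hy⟩, hyx⟩
    choose s hs using hx
    have hv : IsInducing fun y : Z (e l) j => (y.1.1 : X) :=
      IsInducing.subtypeVal.comp IsInducing.subtypeVal
    have hsv : IsInducing ((fun y : Z (e l) j => (y.1.1 : X)) ∘ s) := by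
      rw [show (fun y : Z (e l) j => (y.1.1 : X)) ∘ s = fun x => x.1.1 from funext hs]
      exact IsInducing.subtypeVal.comp IsInducing.subtypeVal
    exact (hZb (e l) j).of_isInducing (hv.of_comp_iff.1 hsv)
  · obtain ⟨i, hi⟩ := (hGmem (N x.1) x.1).2 fun m hm => Nat.find_min (hcov' x.1) hm
    exact ⟨(N x.1, i), hN _, hi⟩

/-- An open cover of a subspace with a clopen basis can be refined by disjoint open sets of the
ambient metric space. -/
theorem HasClopenBasis.exists_disjoint_refinement {X : Type*} [MetricSpace X]
    [SecondCountableTopology X] {Z : Set X} (h : HasClopenBasis Z) {ι : Type*} (U : ι → Set X)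
    (hU : ∀ i, IsOpen (U i)) (hcov : ∀ x, ∃ i, x ∈ U i) :
    ∃ O : ι → Set X, (∀ i, IsOpen (O i)) ∧ (∀ i, O i ⊆ U i) ∧ (∀ x ∈ Z, ∃ i, x ∈ O i) ∧
      ∀ x i j, x ∈ O i → x ∈ O j → i = j := by
  obtain ⟨f, hf, hfU⟩ := h.exists_isLocallyConstant (fun i => Subtype.val ⁻¹' U i)
    (fun i => (hU i).preimage continuous_subtype_val) fun x => hcov x
  let C : ι → Set X := fun i => Subtype.val '' (f ⁻¹' {i})
  let D : ι → Set X := fun i => Subtype.val '' (f ⁻¹' {i})ᶜ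
  have hCD : ∀ i j, i ≠ j → C i ⊆ D j := fun i j hij => by
    rintro _ ⟨x, hx, rfl⟩
    refine ⟨x, fun hx' => hij ?_, rfl⟩
    exact (mem_singleton_iff.1 hx).symm.trans (mem_singleton_iff.1 hx')
  -- Points strictly closer to `C i` than to `D i`. As `C i ⊆ D j` and `C j ⊆ D i`, lying in two of
  -- these sets gives a cyclic chain of strict inequalities.
  refine ⟨fun i => U i ∩ {x | Metric.infEDist x (C i) < Metric.infEDist x (D i)},
    fun i => (hU i).inter (isOpen_lt Metric.continuous_infEDist Metric.continuous_infEDist),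
    fun i => inter_subset_left, fun x hx => ⟨f ⟨x, hx⟩, hfU ⟨x, hx⟩, ?_⟩, fun x i j hi hj => ?_⟩
  · have h0 : Metric.infEDist x (C (f ⟨x, hx⟩)) = 0 :=
      Metric.infEDist_zero_of_mem ⟨⟨x, hx⟩, rfl, rfl⟩
    rw [mem_ofPred_eq, h0, Metric.infEDist_pos_iff_notMem_closure]
    intro hcl
    have : (⟨x, hx⟩ : Z) ∈ closure (f ⁻¹' {f ⟨x, hx⟩})ᶜ := by
      rw [closure_subtype]
      exact hcl
    have hc : IsClosed (f ⁻¹' {f ⟨x, hx⟩})ᶜ := (hf.isClopen_fiber _).compl.isClosed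
    exact hc.closure_subset this rfl
  · by_contra hij
    have h1 := Metric.infEDist_anti (x := x) (hCD i j hij)
    have h2 := Metric.infEDist_anti (x := x) (hCD j i (Ne.symm hij))
    exact absurd ((hi.2.trans_le h2).trans (hj.2.trans_le h1)) (lt_irrefl _)

/-- Each of the `n + 1` pieces contributes a disjoint open family, so a point lies in at most one
member of each. -/
theorem HasZeroDimDecomposition.coveringDimLE {X : Type*} [TopologicalSpace X]
    [TopologicalSpace.MetrizableSpace X] [SecondCountableTopology X] {n : ℕ}
    (h : HasZeroDimDecomposition X n) : CoveringDimLE X n := by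
  classical
  let := TopologicalSpace.metrizableSpaceMetric X
  obtain ⟨Z, hZ, hZb⟩ := h
  refine ⟨by omega, fun U hU hUc => ?_⟩
  choose O hO hOU hOc hOd using fun j => (hZb j).exists_disjoint_refinement
    (fun u : U => (u : Set X)) (fun u => hU u u.2) fun x => by
      obtain ⟨u, hu, hx⟩ := mem_sUnion.1 (hUc ▸ mem_univ x)
      exact ⟨⟨u, hu⟩, hx⟩
  refine ⟨{v | ∃ j u, O j u = v}, ?_, ?_, ?_, fun x => ?_⟩
  · rintro _ ⟨j, u, rfl⟩
    exact hO j u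
  · refine eq_univ_of_forall fun x => ?_
    obtain ⟨j, hj⟩ := hZ x
    obtain ⟨u, hu⟩ := hOc j x hj
    exact ⟨O j u, ⟨j, u, rfl⟩, hu⟩
  · rintro _ ⟨j, u, rfl⟩
    exact ⟨u, u.2, hOU j u⟩
  · let g : Fin (n + 1) → Set X := fun j => if hu : ∃ u, x ∈ O j u then O j hu.choose else ∅
    have hsub : {v ∈ {v | ∃ j u, O j u = v} | x ∈ v} ⊆ g '' univ := by
      rintro _ ⟨⟨j, u, rfl⟩, hx⟩
      have hu : ∃ u, x ∈ O j u := ⟨u, hx⟩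
      refine ⟨j, mem_univ j, ?_⟩
      simp only [g, dif_pos hu]
      rw [hOd j x _ _ hx hu.choose_spec]
    refine ⟨(finite_univ.image g).subset hsub, ?_⟩
    have h1 := ncard_le_ncard hsub (finite_univ.image g)
    have h2 := ncard_image_le (f := g) finite_univ
    simp only [ncard_univ, Nat.card_eq_fintype_card, Fintype.card_fin] at h2
    exact_mod_cast h1.trans h2

/-! ### Dimension of Euclidean space and of spaces covered by charts -/

/-- An interval with rational endpoints has clopen preimage under an irrational-valued coordinate; a
constant coordinate imposes no condition. -/
theorem hasClopenBasis_of_coordinates {X ι : Type*} [TopologicalSpace X] [Fintype ι]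
    {φ : X → ι → ℝ} (hφ : IsInducing φ)
    (h : ∀ i, (∀ x, Irrational (φ x i)) ∨ ∀ x y, φ x i = φ y i) : HasClopenBasis X := by
  intro x U hU hx
  obtain ⟨V, hV, rfl⟩ := hφ.isOpen_iff.1 hU
  obtain ⟨ε, hε, hεV⟩ := Metric.isOpen_iff.1 hV (φ x) hx
  have hcont : ∀ i, Continuous fun y => φ y i := fun i =>
    (continuous_apply i).comp hφ.continuous
  have hC : ∀ i, ∃ C : Set X, IsClopen C ∧ x ∈ C ∧ ∀ y ∈ C, dist (φ y i) (φ x i) < ε := by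
    intro i
    rcases h i with hi | hi
    · obtain ⟨a, ha1, ha2⟩ := exists_rat_btwn (sub_lt_self (φ x i) hε)
      obtain ⟨b, hb1, hb2⟩ := exists_rat_btwn (lt_add_of_pos_right (φ x i) hε)
      refine ⟨{y | φ y i ∈ Ioo (a : ℝ) b}, ⟨?_, isOpen_Ioo.preimage (hcont i)⟩, ⟨ha2, hb1⟩,
        fun y hy => ?_⟩
      · have : {y | φ y i ∈ Ioo (a : ℝ) b} = (fun y => φ y i) ⁻¹' Icc (a : ℝ) b := by
          ext y
          exact ⟨fun hy => Ioo_subset_Icc_self hy, fun hy =>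
            ⟨hy.1.lt_of_ne fun e => (hi y).ne_rat a e.symm, hy.2.lt_of_ne ((hi y).ne_rat b)⟩⟩
        rw [this]
        exact isClosed_Icc.preimage (hcont i)
      · rw [Real.dist_eq, abs_lt]
        constructor <;> linarith [hy.1, hy.2]
    · exact ⟨univ, isClopen_univ, mem_univ x, fun y _ => by rwa [hi y x, dist_self]⟩
  choose C hCc hxC hCε using hC
  exact ⟨⋂ i, C i, isClopen_iInter_of_finite hCc, mem_iInter.2 hxC, fun y hy =>
    hεV ((dist_pi_lt_iff hε).2 fun i => hCε i y (mem_iInter.1 hy i))⟩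

/-- The pieces consist of the points with a given number of rational coordinates. -/
theorem hasZeroDimDecomposition_pi_real (ι : Type*) [Fintype ι] :
    HasZeroDimDecomposition (ι → ℝ) (Fintype.card ι) := by
  classical
  let c : (ι → ℝ) → Finset ι := fun x => Finset.univ.filter fun i => ¬ Irrational (x i)
  refine ⟨fun j => {x | (c x).card = j}, fun x => ⟨⟨(c x).card, ?_⟩, rfl⟩, fun j => ?_⟩
  · exact Nat.lt_succ_of_le (Finset.card_le_univ _)
  -- Countably many prescriptions of rational values at exactly `j` coordinates. On the
  -- corresponding closed set all other coordinates are irrational.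
  let κ := {q : ι → Option ℚ // (Finset.univ.filter fun i => (q i).isSome).card = j}
  refine HasClopenBasis.of_iUnion_isClosed
    (fun q : κ => {x | ∀ i, ∀ r ∈ q.1 i, x.1 i = (r : ℝ)}) (fun q => ?_) (fun q => ?_)
    fun x => ?_
  · simp only [ofPred_forall]
    refine isClosed_iInter fun i => isClosed_iInter fun r => isClosed_iInter fun _ =>
      isClosed_eq ?_ continuous_const
    exact (continuous_apply i).comp continuous_subtype_val
  · refine hasClopenBasis_of_coordinates (φ := fun x => x.1.1)
      (IsInducing.subtypeVal.comp IsInducing.subtypeVal) fun i => ?_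
    cases hq : q.1 i with
    | none =>
      refine Or.inl fun x => ?_
      have hsub : (Finset.univ.filter fun i => (q.1 i).isSome) ⊆ c x.1.1 := by
        intro l hl
        simp only [Finset.mem_filter, Finset.mem_univ, true_and] at hl
        obtain ⟨r, hr⟩ := Option.isSome_iff_exists.1 hl
        simp only [c, Finset.mem_filter, Finset.mem_univ, true_and]
        rw [x.2 l r hr]
        exact Rat.not_irrational r
      have heq := Finset.eq_of_subset_of_card_le hsub (by rw [q.2]; exact x.1.2.le)
      by_contra hi
      have : i ∈ c x.1.1 := by simpa [c] using hi
      rw [← heq] at this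
      simp [hq] at this
    | some r =>
      exact Or.inr fun x y => (x.2 i r hq).trans (y.2 i r hq).symm
  · have hx : ∀ i, ∃ o : Option ℚ, (o.isSome ↔ ¬ Irrational (x.1 i)) ∧
        ∀ r ∈ o, x.1 i = (r : ℝ) := fun i => by
      by_cases hi : Irrational (x.1 i)
      · exact ⟨none, by simp [hi], by simp⟩
      · obtain ⟨r, hr⟩ := not_not.1 hi
        exact ⟨some r, by simp [hi], by simp [hr]⟩
    choose q hq hqr using hx
    refine ⟨⟨q, ?_⟩, fun i r hr => hqr i r hr⟩
    simp only [hq]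
    exact x.2

/-- A separable metrizable space covered by countably many injective continuous images of open
subsets of `ℝ^ι` has dimension at most the cardinality of `ι`. -/
theorem hasZeroDimDecomposition_of_charts {X Y ι κ : Type*} [TopologicalSpace X]
    [TopologicalSpace.MetrizableSpace X] [SecondCountableTopology X] [TopologicalSpace Y]
    [T2Space Y] [Fintype ι] [Countable κ] {f : X → Y} (hf : IsInducing f)
    (ψ : κ → (ι → ℝ) → Y) (O : κ → Set (ι → ℝ)) (hO : ∀ k, IsOpen (O k))
    (hψ : ∀ k, ContinuousOn (ψ k) (O k)) (hinj : ∀ k, InjOn (ψ k) (O k))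
    (hcov : ∀ x, ∃ k, f x ∈ ψ k '' O k) : HasZeroDimDecomposition X (Fintype.card ι) := by
  -- Compact exhaustion: on a compact set an injective continuous map to a Hausdorff space is a
  -- closed embedding, so continuity of the inverse chart is automatic.
  have hσ : ∀ k, ∃ K : ℕ → Set (ι → ℝ), (∀ l, IsCompact (K l)) ∧ ⋃ l, K l = O k := fun k => by
    have := (hO k).locallyCompactSpace
    have : IsSigmaCompact (O k) := isSigmaCompact_iff_sigmaCompactSpace.2 inferInstance
    exact this
  choose K hK hKO using hσ
  have hKsub : ∀ k l, K k l ⊆ O k := fun k l => hKO k ▸ subset_iUnion _ l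
  refine HasZeroDimDecomposition.of_iUnion_isClosed
    (fun p : κ × ℕ => f ⁻¹' (ψ p.1 '' K p.1 p.2)) (fun p => ?_) (fun p => ?_) fun x => ?_
  · exact ((hK _ _).image_of_continuousOn ((hψ _).mono (hKsub _ _))).isClosed.preimage
      hf.continuous
  · obtain ⟨k, l⟩ := p
    have := isCompact_iff_compactSpace.1 (hK k l)
    let g : K k l → Y := (K k l).domRestrict (ψ k)
    have hg : IsClosedEmbedding g :=
      ((hψ k).mono (hKsub k l)).domRestrict.isClosedEmbedding
        (injOn_iff_injective.1 ((hinj k).mono (hKsub k l)))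
    have hx : ∀ x : f ⁻¹' (ψ k '' K k l), ∃ y : K k l, g y = f x := fun x => by
      obtain ⟨y, hy, hyx⟩ := x.2
      exact ⟨⟨y, hy⟩, hyx⟩
    choose s hs using hx
    have hgs : IsInducing (g ∘ s) := by
      rw [show g ∘ s = f ∘ Subtype.val from funext hs]
      exact hf.comp IsInducing.subtypeVal
    have hsi : IsInducing s := hg.isInducing.of_comp_iff.1 hgs
    exact (hasZeroDimDecomposition_pi_real ι).of_isInducing (IsInducing.subtypeVal.comp hsi)
  · obtain ⟨k, y, hy, hyx⟩ := hcov x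
    rw [← hKO k] at hy
    obtain ⟨l, hl⟩ := mem_iUnion.1 hy
    exact ⟨(k, l), y, hl, hyx⟩

/-! ### Continuous dependence of orthogonal projections -/

section Projection

variable {E F : Type*} [NormedAddCommGroup E] [InnerProductSpace ℝ E] [FiniteDimensional ℝ E]
  [NormedAddCommGroup F] [InnerProductSpace ℝ F] [FiniteDimensional ℝ F]

open ContinuousLinearMap in
theorem isUnit_adjoint_comp_self {A : F →L[ℝ] E} (hA : Function.Injective A) :
    IsUnit ((adjoint A) ∘L A) := by
  have hinj : Function.Injective ((adjoint A) ∘L A) := by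
    rw [injective_iff_map_eq_zero]
    intro x hx
    have h : inner ℝ (((adjoint A) ∘L A) x) x = 0 := by rw [hx, inner_zero_left]
    rw [ContinuousLinearMap.comp_apply, adjoint_inner_left, inner_self_eq_zero] at h
    exact hA (h.trans (map_zero A).symm)
  rw [ContinuousLinearMap.isUnit_iff_bijective]
  exact ⟨hinj, LinearMap.injective_iff_surjective (f := (((adjoint A) ∘L A : F →L[ℝ] F) :
    F →ₗ[ℝ] F)).1 hinj⟩

open ContinuousLinearMap in
-- The normal equations. The right side is visibly continuous in `A`, because inversion is
-- continuous at units.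
theorem starProjection_range_eq {A : F →L[ℝ] E} (hA : Function.Injective A) :
    (LinearMap.range (A : F →ₗ[ℝ] E)).starProjection =
      A ∘L Ring.inverse ((adjoint A) ∘L A) ∘L adjoint A := by
  ext1 y
  refine Submodule.eq_starProjection_of_mem_of_inner_eq_zero ⟨_, rfl⟩ ?_
  rintro _ ⟨c, rfl⟩
  have h := Ring.mul_inverse_cancel _ (isUnit_adjoint_comp_self hA)
  have h2 := congrArg (fun T : F →L[ℝ] F => T (adjoint A y)) h
  simp only [ContinuousLinearMap.mul_def, ContinuousLinearMap.comp_apply,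
    one_apply_eq_self] at h2
  simp only [ContinuousLinearMap.coe_coe, ContinuousLinearMap.comp_apply]
  rw [← adjoint_inner_left, map_sub, h2, sub_self, inner_zero_left]

open ContinuousLinearMap in
/-- The orthogonal projection onto the span of a linearly independent family depends continuously
on the family. -/
theorem continuousOn_starProjection_span {T ι : Type*} [TopologicalSpace T] [Fintype ι]
    {v : T → ι → E} {S : Set T} (hv : ∀ i, ContinuousOn (fun x => v x i) S)
    (hli : ∀ x ∈ S, LinearIndependent ℝ (v x)) :
    ContinuousOn (fun x => (Submodule.span ℝ (range (v x))).starProjection) S := by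
  classical
  let A : T → EuclideanSpace ℝ ι →L[ℝ] E := fun x =>
    ∑ i, (EuclideanSpace.proj (𝕜 := ℝ) i).smulRight (v x i)
  have hAapply : ∀ x c, A x c = ∑ i, c i • v x i := fun x c => by
    simp [A]
  have hA : ContinuousOn A S := by
    refine continuousOn_finsetSum _ fun i _ => ?_
    exact ((ContinuousLinearMap.smulRightL ℝ (EuclideanSpace ℝ ι) E
      (EuclideanSpace.proj i)).continuous.comp_continuousOn (hv i))
  have hrange : ∀ x, LinearMap.range (A x : EuclideanSpace ℝ ι →ₗ[ℝ] E) =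
      Submodule.span ℝ (range (v x)) := fun x => by
    ext y
    rw [Submodule.mem_span_range_iff_exists_fun, LinearMap.mem_range]
    constructor
    · rintro ⟨c, rfl⟩
      exact ⟨c, (hAapply x c).symm⟩
    · rintro ⟨c, rfl⟩
      exact ⟨WithLp.toLp 2 c, hAapply x _⟩
  have hinj : ∀ x ∈ S, Function.Injective (A x) := fun x hx => by
    rw [injective_iff_map_eq_zero]
    intro c hc
    ext i
    exact Fintype.linearIndependent_iff.1 (hli x hx) c (hAapply x c ▸ hc) i
  have key : ContinuousOn (fun x => A x ∘L Ring.inverse ((adjoint (A x)) ∘L A x) ∘L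
      adjoint (A x)) S := by
    have hadj : ContinuousOn (fun x => adjoint (A x)) S :=
      (adjoint (𝕜 := ℝ) (E := EuclideanSpace ℝ ι) (F := E)).continuous.comp_continuousOn hA
    refine hA.clm_comp (ContinuousOn.clm_comp (fun x hx => ?_) hadj)
    obtain ⟨u, hu⟩ := isUnit_adjoint_comp_self (hinj x hx)
    have hinv := NormedRing.inverse_continuousAt u
    rw [hu] at hinv
    exact ContinuousAt.comp_continuousWithinAt (f := fun x => (adjoint (A x)) ∘L A x) hinv
      (hadj.clm_comp hA x hx)
  refine key.congr fun x hx => ?_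
  simp only [← starProjection_range_eq (hinj x hx), hrange]

theorem starProjection_eq_iff {E : Type*} [NormedAddCommGroup E] [InnerProductSpace ℝ E]
    {K L : Submodule ℝ E} [K.HasOrthogonalProjection] [L.HasOrthogonalProjection] : K.starProjection = L.starProjection ↔ K = L := by
  constructor
  · intro h
    ext x
    rw [← Submodule.starProjection_eq_self_iff, h, Submodule.starProjection_eq_self_iff]
  · rintro rfl
    rfl

end Projection

/-! ### Planes as linear subspaces one dimension up -/

section Cone

variable {E : Type*} [NormedAddCommGroup E] [InnerProductSpace ℝ E]

/-- The linear subspace of `E × ℝ` spanned by an affine subspace of `E` placed at height `1`. -/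
def cone (P : AffineSubspace ℝ E) : Submodule ℝ (E × ℝ) :=
  Submodule.span ℝ ((fun p => (p, (1 : ℝ))) '' (P : Set E))

/-- The affine subspace of `E` cut out by a linear subspace of `E × ℝ` at height `1`. -/
def slice (U : Submodule ℝ (E × ℝ)) : AffineSubspace ℝ E where
  carrier := {p | (p, (1 : ℝ)) ∈ U}
  smul_vsub_vadd_mem' c p₁ p₂ p₃ h₁ h₂ h₃ := by
    have := U.add_mem (U.smul_mem c (U.sub_mem h₁ h₂)) h₃
    simpa using this

theorem cone_le_iff {P : AffineSubspace ℝ E} {U : Submodule ℝ (E × ℝ)} :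
    cone P ≤ U ↔ P ≤ slice U := by
  rw [cone, Submodule.span_le, image_subset_iff]
  rfl

theorem gc_cone_slice : GaloisConnection (cone (E := E)) slice := fun _ _ => cone_le_iff

theorem cone_mono {P Q : AffineSubspace ℝ E} (h : P ≤ Q) : cone P ≤ cone Q :=
  gc_cone_slice.monotone_l h

theorem mk_one_mem_cone {P : AffineSubspace ℝ E} {p : E} (hp : p ∈ P) : (p, (1 : ℝ)) ∈ cone P :=
  Submodule.subset_span ⟨p, hp, rfl⟩

/-- The cone is the line through `(p, 1)` plus the direction at height `0`; subtracting `t • (p, 1)`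
removes the height. -/
theorem mem_cone_iff {P : AffineSubspace ℝ E} {p : E} (hp : p ∈ P) (v : E) (t : ℝ) :
    (v, t) ∈ cone P ↔ v - t • p ∈ P.direction := by
  constructor
  · intro h
    have hle : cone P ≤ P.direction.comap
        (LinearMap.fst ℝ E ℝ - (LinearMap.snd ℝ E ℝ).smulRight p) := by
      rw [cone, Submodule.span_le]
      rintro _ ⟨q, hq, rfl⟩
      simpa using P.vsub_mem_direction hq hp
    simpa using hle h
  · intro h
    obtain ⟨q, hq, hqv⟩ := (AffineSubspace.mem_direction_iff_eq_vsub_left hp _).1 h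
    have h1 : (v, t) = t • (p, (1 : ℝ)) + ((p, (1 : ℝ)) - (q, (1 : ℝ))) := by
      have hv : v = t • p + (p - q) := by
        rw [vsub_eq_sub] at hqv
        rw [← hqv]
        abel
      ext1
      · simpa using hv
      · simp
    rw [h1]
    exact add_mem (Submodule.smul_mem _ _ (mk_one_mem_cone hp))
      (sub_mem (mk_one_mem_cone hp) (mk_one_mem_cone hq))

theorem cone_bot : cone (⊥ : AffineSubspace ℝ E) = ⊥ := gc_cone_slice.l_bot

theorem cone_sup (P Q : AffineSubspace ℝ E) : cone (P ⊔ Q) = cone P ⊔ cone Q :=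
  gc_cone_slice.l_sup

theorem cone_top : cone (⊤ : AffineSubspace ℝ E) = ⊤ :=
  eq_top_iff.2 fun x _ => (mem_cone_iff (AffineSubspace.mem_top ℝ E 0) x.1 x.2).2 (by simp)

theorem finrank_cone_of_mem [FiniteDimensional ℝ E] {P : AffineSubspace ℝ E} {p : E}
    (hp : p ∈ P) : Module.finrank ℝ (cone P) = Module.finrank ℝ P.direction + 1 := by
  let f : (P.direction × ℝ) →ₗ[ℝ] E × ℝ :=
    ((P.direction.subtype.comp (LinearMap.fst ℝ _ ℝ)) +
      (LinearMap.snd ℝ P.direction ℝ).smulRight p).prod (LinearMap.snd ℝ P.direction ℝ)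
  have hf : ∀ x, f x = ((x.1 : E) + x.2 • p, x.2) := fun x => rfl
  have hinj : Function.Injective f := by
    intro x y hxy
    rw [hf, hf, Prod.mk.injEq] at hxy
    obtain ⟨h1, h2⟩ := hxy
    rw [h2, add_left_inj] at h1
    exact Prod.ext (Subtype.ext h1) h2
  have hr : LinearMap.range f = cone P := by
    ext ⟨v, t⟩
    rw [mem_cone_iff hp]
    constructor
    · rintro ⟨x, hx⟩
      rw [hf, Prod.mk.injEq] at hx
      obtain ⟨rfl, rfl⟩ := hx
      simp
    · intro h
      exact ⟨(⟨_, h⟩, t), by rw [hf]; simp⟩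
  rw [← hr, LinearMap.finrank_range_of_inj hinj]
  simp

end Cone

/-- The convention that the empty plane has dimension `-1` makes the formula uniform. -/
theorem finrank_cone {m : ℕ} (P : AffineSubspace ℝ (EuclideanSpace ℝ (Fin m))) :
    (Module.finrank ℝ (cone P) : ℤ) = planeDim P + 1 := by
  rw [planeDim]
  split_ifs with h
  · rw [h, cone_bot]
    simp
  · obtain ⟨p, hp⟩ := (AffineSubspace.nonempty_iff_ne_bot P).2 h
    rw [finrank_cone_of_mem hp]
    push_cast
    rfl

theorem planeFoot_eq {m : ℕ} {P : AffineSubspace ℝ (EuclideanSpace ℝ (Fin m))}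
    {p : EuclideanSpace ℝ (Fin m)} (hp : p ∈ P) :
    planeFoot P = p - P.direction.starProjection p := by
  have hne : Nonempty P := ⟨⟨p, hp⟩⟩
  rw [planeFoot, dif_pos hne, EuclideanGeometry.orthogonalProjection_apply_mem _ hp]
  simp only [vsub_eq_sub, zero_sub, map_neg, vadd_eq_add, Submodule.coe_neg]
  rw [neg_add_eq_sub]
  rfl

theorem planeFoot_mem {m : ℕ} {P : AffineSubspace ℝ (EuclideanSpace ℝ (Fin m))}
    (h : (P : Set (EuclideanSpace ℝ (Fin m))).Nonempty) : planeFoot P ∈ P := by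
  obtain ⟨p, hp⟩ := h
  have hne : Nonempty P := ⟨⟨p, hp⟩⟩
  rw [planeFoot, dif_pos hne]
  exact EuclideanGeometry.orthogonalProjection_mem _

theorem planeCoord_injective {m : ℕ} {d : ℤ} :
    Function.Injective (planeCoord : PlaneSpace m d → _) := by
  rintro ⟨P, hP⟩ ⟨Q, hQ⟩ h
  simp only [planeCoord, Prod.mk.injEq, starProjection_eq_iff] at h
  refine Subtype.ext ?_
  change P = Q
  -- The empty plane and the point `{0}` have equal coordinates; only the fixed dimension `d`
  -- separates them.
  by_cases hPb : P = ⊥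
  · rw [planeDim, if_pos hPb] at hP
    by_contra hne
    rw [planeDim, if_neg fun hQb => hne (hPb.trans hQb.symm)] at hQ
    omega
  · by_cases hQb : Q = ⊥
    · rw [planeDim, if_neg hPb] at hP
      rw [planeDim, if_pos hQb] at hQ
      omega
    · have h1 := planeFoot_mem ((AffineSubspace.nonempty_iff_ne_bot P).2 hPb)
      have h2 := planeFoot_mem ((AffineSubspace.nonempty_iff_ne_bot Q).2 hQb)
      exact AffineSubspace.ext_of_direction_eq h.1 ⟨_, h1, h.2 ▸ h2⟩

/-! ### Coordinates of a plane from vectors spanning its cone -/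

section AffineChart

variable {E ι : Type*} [NormedAddCommGroup E] [InnerProductSpace ℝ E]

/-- The point where the line spanned by `w` meets height `1`. -/
noncomputable def dehomogenize (w : E × ℝ) : E := w.2⁻¹ • w.1

/-- For vectors `w i` spanning a linear subspace of `E × ℝ`, vectors that span the
direction of its slice at height `1`, provided that `w j` has nonzero height. -/
noncomputable def directionVectors (w : ι → E × ℝ) (j : ι) (i : {i // i ≠ j}) : E :=
  (w i).1 - (w i).2 • dehomogenize (w j)

theorem dehomogenize_mem {U : Submodule ℝ (E × ℝ)} {w : E × ℝ} (hw : w ∈ U) (h : w.2 ≠ 0) :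
    (dehomogenize w, (1 : ℝ)) ∈ U := by
  have : (dehomogenize w, (1 : ℝ)) = w.2⁻¹ • w := by
    ext1
    · rfl
    · simp [h]
  rw [this]
  exact U.smul_mem _ hw

theorem mem_span_iff_mem_span_directionVectors {w : ι → E × ℝ} {j : ι} (hj : (w j).2 ≠ 0)
    (v : E) (t : ℝ) : (v, t) ∈ Submodule.span ℝ (range w) ↔
      v - t • dehomogenize (w j) ∈ Submodule.span ℝ (range (directionVectors w j)) := by
  set p := dehomogenize (w j) with hp
  have hpw : (p, (1 : ℝ)) ∈ Submodule.span ℝ (range w) :=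
    dehomogenize_mem (Submodule.subset_span ⟨j, rfl⟩) hj
  constructor
  · intro h
    have hle : Submodule.span ℝ (range w) ≤
        (Submodule.span ℝ (range (directionVectors w j))).comap
          (LinearMap.fst ℝ E ℝ - (LinearMap.snd ℝ E ℝ).smulRight p) := by
      rw [Submodule.span_le]
      rintro _ ⟨i, rfl⟩
      by_cases hi : i = j
      · subst hi
        simp [hp, dehomogenize, hj]
      · exact Submodule.subset_span ⟨⟨i, hi⟩, rfl⟩
    exact hle h
  · intro h
    have hle : Submodule.span ℝ (range (directionVectors w j)) ≤
        (Submodule.span ℝ (range w)).comap (LinearMap.inl ℝ E ℝ) := by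
      rw [Submodule.span_le]
      rintro _ ⟨i, rfl⟩
      have : LinearMap.inl ℝ E ℝ (directionVectors w j i) = w i - (w i).2 • (p, (1 : ℝ)) := by
        ext1
        · rfl
        · simp
      rw [SetLike.mem_coe, Submodule.mem_comap, this]
      exact sub_mem (Submodule.subset_span ⟨i, rfl⟩) (Submodule.smul_mem _ _ hpw)
    have : (v, t) = LinearMap.inl ℝ E ℝ (v - t • p) + t • (p, (1 : ℝ)) := by
      ext1 <;> simp
    rw [this]
    exact add_mem (hle h) (Submodule.smul_mem _ _ hpw)

theorem linearIndependent_directionVectors {w : ι → E × ℝ} (hw : LinearIndependent ℝ w) {j : ι}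
    (hj : (w j).2 ≠ 0) : LinearIndependent ℝ (directionVectors w j) := by
  have h1 : LinearIndependent ℝ fun i : {i // i ≠ j} => w i := hw.comp _ Subtype.val_injective
  refine h1.map (f := LinearMap.fst ℝ E ℝ -
    (LinearMap.snd ℝ E ℝ).smulRight (dehomogenize (w j))) ?_
  -- The map `(v, t) ↦ v - t • p`, with `p` the dehomogenization of `w j`, has kernel the line
  -- through `w j`, which misses the span of the other vectors.
  have h2 := hw.disjoint_span_image (s := {i | i ≠ j}) (t := {j}) (by simp)
  rw [image_singleton, image_eq_range] at h2
  refine h2.mono_right fun x hx => Submodule.mem_span_singleton.2 ⟨x.2 * (w j).2⁻¹, ?_⟩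
  have hx1 : x.1 = x.2 • dehomogenize (w j) := by
    simpa [sub_eq_zero] using hx
  ext1
  · rw [hx1, dehomogenize, smul_smul]
    rfl
  · simp [hj]

/-- The coordinates of the slice at height `1` of the span of `w`, computed from a vector `w j` of
nonzero height. -/
noncomputable def sliceCoord [FiniteDimensional ℝ E] (w : ι → E × ℝ) (j : ι) :
    (E →L[ℝ] E) × E :=
  ((Submodule.span ℝ (range (directionVectors w j))).starProjection,
    dehomogenize (w j) -
      (Submodule.span ℝ (range (directionVectors w j))).starProjection (dehomogenize (w j)))

theorem continuousOn_sliceCoord [FiniteDimensional ℝ E] [Fintype ι] {T : Type*}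
    [TopologicalSpace T] {w : T → ι → E × ℝ} (hc : ∀ i, Continuous fun x => w x i)
    (hw : ∀ x, LinearIndependent ℝ (w x)) (j : ι) :
    ContinuousOn (fun x => sliceCoord (w x) j) {x | (w x j).2 ≠ 0} := by
  classical
  have hp : ContinuousOn (fun x => dehomogenize (w x j)) {x | (w x j).2 ≠ 0} :=
    ((hc j).snd.continuousOn.inv₀ fun x hx => hx).smul (hc j).fst.continuousOn
  have hP := continuousOn_starProjection_span (v := fun x => directionVectors (w x) j)
    (S := {x | (w x j).2 ≠ 0})
    (fun i => (hc i).fst.continuousOn.sub ((hc i).snd.continuousOn.smul hp))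
    fun x hx => linearIndependent_directionVectors (hw x) hx
  exact hP.prodMk (hp.sub (hP.clm_apply hp))

/-- The coordinates fix the direction, and the base point modulo it; these determine the span. -/
theorem span_eq_of_sliceCoord_eq [FiniteDimensional ℝ E] {w w' : ι → E × ℝ} {j : ι}
    (hj : (w j).2 ≠ 0) (hj' : (w' j).2 ≠ 0) (h : sliceCoord w j = sliceCoord w' j) :
    Submodule.span ℝ (range w) = Submodule.span ℝ (range w') := by
  simp only [sliceCoord, Prod.mk.injEq, starProjection_eq_iff] at h
  obtain ⟨h1, h2⟩ := h
  ext ⟨v, t⟩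
  rw [mem_span_iff_mem_span_directionVectors hj, mem_span_iff_mem_span_directionVectors hj', ← h1]
  simp only [← h1] at h2
  set D := Submodule.span ℝ (range (directionVectors w j))
  have h3 : dehomogenize (w j) - dehomogenize (w' j) ∈ D := by
    have : dehomogenize (w j) - dehomogenize (w' j) =
        D.starProjection (dehomogenize (w j)) - D.starProjection (dehomogenize (w' j)) := by
      rw [sub_eq_sub_iff_sub_eq_sub]
      exact h2
    rw [this]
    exact sub_mem (Submodule.starProjection_apply_mem _ _)
      (Submodule.starProjection_apply_mem _ _)
  have h4 : v - t • dehomogenize (w' j) =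
      v - t • dehomogenize (w j) + t • (dehomogenize (w j) - dehomogenize (w' j)) := by
    rw [smul_sub]
    abel
  rw [h4]
  exact (D.add_mem_iff_left (D.smul_mem t h3)).symm

theorem planeCoord_eq_sliceCoord {m : ℕ} {d : ℤ} {P : PlaneSpace m d}
    {w : ι → EuclideanSpace ℝ (Fin m) × ℝ} {j : ι} (hj : (w j).2 ≠ 0)
    (hw : Submodule.span ℝ (range w) = cone P.1)
    (hne : (P.1 : Set (EuclideanSpace ℝ (Fin m))).Nonempty) : planeCoord P = sliceCoord w j := by
  obtain ⟨q, hq⟩ := hne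
  have hdir : P.1.direction = Submodule.span ℝ (range (directionVectors w j)) := by
    ext v
    have h1 := mem_cone_iff hq v 0
    have h2 := mem_span_iff_mem_span_directionVectors hj v 0
    rw [hw] at h2
    simpa using h1.symm.trans h2
  have hp : dehomogenize (w j) ∈ P.1 := by
    have h1 := dehomogenize_mem (Submodule.subset_span (mem_range_self j)) hj
    rw [hw, mem_cone_iff hq, one_smul] at h1
    simpa using AffineSubspace.vadd_mem_of_mem_direction h1 hq
  rw [planeCoord, sliceCoord, planeFoot_eq hp]
  simp only [hdir]

end AffineChart

/-! ### Matrix charts on the subspaces of `K` -/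

section Charts

variable {V : Type*} [AddCommGroup V] [Module ℝ V] {s q : ℕ}

/-- The vectors `e i + ∑ M i j e j`, spanning the graph of the matrix `M` with respect to a basis
split into two parts. -/
noncomputable def graphVectors {K : Type*} [AddCommGroup K] [Module ℝ K]
    (e : Module.Basis (Fin s ⊕ Fin q) ℝ K) (M : Fin s × Fin q → ℝ) (i : Fin s) : K :=
  e (Sum.inl i) + ∑ j, M (i, j) • e (Sum.inr j)

theorem repr_graphVectors_inl {K : Type*} [AddCommGroup K] [Module ℝ K]
    (e : Module.Basis (Fin s ⊕ Fin q) ℝ K) (M : Fin s × Fin q → ℝ) (i l : Fin s) :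
    e.repr (graphVectors e M i) (Sum.inl l) = if i = l then 1 else 0 := by
  simp [graphVectors, Finsupp.single_apply]

theorem repr_graphVectors_inr {K : Type*} [AddCommGroup K] [Module ℝ K]
    (e : Module.Basis (Fin s ⊕ Fin q) ℝ K) (M : Fin s × Fin q → ℝ) (i : Fin s) (l : Fin q) :
    e.repr (graphVectors e M i) (Sum.inr l) = M (i, l) := by
  simp [graphVectors, Finsupp.single_apply]

theorem linearIndependent_graphVectors {K : Type*} [AddCommGroup K] [Module ℝ K]
    (e : Module.Basis (Fin s ⊕ Fin q) ℝ K) (M : Fin s × Fin q → ℝ) :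
    LinearIndependent ℝ (graphVectors e M) := by
  rw [Fintype.linearIndependent_iff]
  intro c hc l
  have := congrArg (fun x => e.repr x (Sum.inl l)) hc
  simpa [repr_graphVectors_inl] using this

theorem eq_of_graphVectors_mem_span {K : Type*} [AddCommGroup K] [Module ℝ K]
    (e : Module.Basis (Fin s ⊕ Fin q) ℝ K) {M N : Fin s × Fin q → ℝ}
    (h : ∀ i, graphVectors e M i ∈ Submodule.span ℝ (range (graphVectors e N))) : M = N := by
  funext ⟨i, l⟩
  obtain ⟨c, hc⟩ := Submodule.mem_span_range_iff_exists_fun ℝ |>.1 (h i)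
  have h1 : ∀ t, c t = if i = t then 1 else 0 := fun t => by
    have := congrArg (fun x => e.repr x (Sum.inl t)) hc
    simpa [repr_graphVectors_inl] using this
  have := congrArg (fun x => e.repr x (Sum.inr l)) hc
  simpa [repr_graphVectors_inr, h1] using this.symm

/-- Every subspace is the graph of a matrix, for a suitable splitting of a given basis. -/
theorem exists_graphVectors_mem {K : Type*} [AddCommGroup K] [Module ℝ K] {k : ℕ}
    (B : Module.Basis (Fin k) ℝ K) (hk : k = s + q) (L : Submodule ℝ K)
    (hL : Module.finrank ℝ L = s) :
    ∃ (σ : Fin k ≃ Fin s ⊕ Fin q) (M : Fin s × Fin q → ℝ),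
      ∀ i, graphVectors (B.reindex σ) M i ∈ L := by
  classical
  have : FiniteDimensional ℝ K := B.finiteDimensional_of_finite
  -- Basis vectors whose classes form a basis of `K / L` become the second block. The other `s`
  -- vectors are combinations of them modulo `L`, which gives the matrix up to sign.
  obtain ⟨κ, a, ha, hspan, hli⟩ := exists_linearIndependent' ℝ (L.mkQ ∘ B)
  have hspan' : Submodule.span ℝ (range (L.mkQ ∘ B ∘ a)) = ⊤ := by
    rw [← Function.comp_assoc, hspan, range_comp, ← Submodule.map_span, B.span_eq,
      Submodule.map_top, Submodule.range_mkQ]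
  have : Finite κ := Finite.of_injective a ha
  have := Fintype.ofFinite κ
  have hκ : Fintype.card κ = q := by
    rw [← finrank_span_eq_card hli, Function.comp_assoc, hspan', finrank_top]
    have h1 := L.finrank_quotient_add_finrank
    have h2 := Module.finrank_eq_card_basis B
    rw [Fintype.card_fin] at h2
    omega
  have hcompl : Fintype.card {i // i ∉ range a} = s := by
    have h1 := Fintype.card_subtype_compl (fun i => i ∈ range a)
    have h2 : Fintype.card {i // i ∈ range a} = q := by
      rw [← hκ]
      exact Fintype.card_congr (Equiv.ofInjective a ha).symm
    rw [h1, h2, Fintype.card_fin]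
    omega
  let e1 : Fin s ≃ {i // i ∉ range a} := (Fintype.equivFinOfCardEq hcompl).symm
  let e2 : Fin q ≃ {i // i ∈ range a} :=
    (Fintype.equivFinOfCardEq hκ).symm.trans (Equiv.ofInjective a ha)
  let σ : Fin s ⊕ Fin q ≃ Fin k :=
    ((Equiv.sumComm _ _).trans (Equiv.sumCongr e2 e1)).trans (Equiv.sumCompl _)
  have hrange : range (L.mkQ ∘ B ∘ a) = range fun j : Fin q => L.mkQ (B (σ (Sum.inr j))) := by
    ext y
    constructor
    · rintro ⟨t, rfl⟩
      refine ⟨e2.symm ⟨a t, t, rfl⟩, ?_⟩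
      simp [σ]
    · rintro ⟨j, rfl⟩
      obtain ⟨t, ht⟩ := (e2 j).2
      refine ⟨t, ?_⟩
      simp [σ, ht]
  rw [hrange] at hspan'
  have hM : ∀ i : Fin s, ∃ c : Fin q → ℝ,
      ∑ j, c j • L.mkQ (B (σ (Sum.inr j))) = L.mkQ (B (σ (Sum.inl i))) := fun i =>
    (Submodule.mem_span_range_iff_exists_fun ℝ).1 (hspan' ▸ Submodule.mem_top)
  choose c hc using hM
  refine ⟨σ.symm, fun p => - c p.1 p.2, fun i => ?_⟩
  rw [← Submodule.Quotient.mk_eq_zero, ← Submodule.mkQ_apply, graphVectors, map_add,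
    Module.Basis.reindex_apply, Equiv.symm_symm, ← hc i, map_sum, ← Finset.sum_add_distrib]
  exact Finset.sum_eq_zero fun j _ => by
    rw [Module.Basis.reindex_apply, Equiv.symm_symm, map_smul, ← add_smul, add_neg_cancel,
      zero_smul]

variable {W₁ W₂ W₃ : Submodule ℝ V}

theorem exists_decomposition (K : Submodule ℝ V) (hK : K ≤ W₁ ⊔ W₂) :
    ∃ a b : K →ₗ[ℝ] V, (∀ x, a x ∈ W₁) ∧ (∀ x, b x ∈ W₂) ∧ ∀ x, a x + b x = x := by
  let B := Module.Basis.ofVectorSpace ℝ K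
  have h : ∀ i, ∃ y ∈ W₁, ∃ z ∈ W₂, y + z = (B i : V) := fun i =>
    Submodule.mem_sup.1 (hK (B i).2)
  choose y hy z hz hyz using h
  refine ⟨B.constr ℝ y, B.constr ℝ z, fun x => ?_, fun x => ?_, fun x => ?_⟩
  · rw [Module.Basis.constr_apply]
    exact Submodule.sum_mem _ fun i _ => W₁.smul_mem _ (hy i)
  · rw [Module.Basis.constr_apply]
    exact Submodule.sum_mem _ fun i _ => W₂.smul_mem _ (hz i)
  · have : B.constr ℝ y + B.constr ℝ z = K.subtype :=
      B.ext fun i => by simp [Module.Basis.constr_basis, hyz i]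
    exact LinearMap.congr_fun this x

theorem eq_of_add_eq_add_of_disjoint (h : Disjoint W₁ W₂) {x x' y y' : V} (hx : x ∈ W₁)
    (hx' : x' ∈ W₁) (hy : y ∈ W₂) (hy' : y' ∈ W₂) (hxy : x + y = x' + y') : x = x' ∧ y = y' := by
  have h1 : x - x' = y' - y := by rw [sub_eq_sub_iff_add_eq_add, hxy, add_comm]
  have h2 : x - x' = 0 :=
    Submodule.disjoint_def.1 h _ (sub_mem hx hx') (h1 ▸ sub_mem hy' hy)
  rw [h2] at h1
  exact ⟨sub_eq_zero.1 h2, (sub_eq_zero.1 h1.symm).symm⟩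

/-- The components in `W₁` and `W₂` of the vectors spanning a subspace of `K`. -/
noncomputable def splitVectors {K : Submodule ℝ V} (a b : K →ₗ[ℝ] V)
    (e : Module.Basis (Fin s ⊕ Fin q) ℝ K) (M : Fin s × Fin q → ℝ) : Fin s ⊕ Fin s → V :=
  Sum.elim (a ∘ graphVectors e M) (b ∘ graphVectors e M)

/-- Both components are injective on `K`: if one vanishes at `x`, then `x` lies in `W₃` and in `W₁`
or `W₂`, so it is zero. -/
theorem linearIndependent_splitVectors {K : Submodule ℝ V} (hK : K ≤ W₃) (h₁₂ : Disjoint W₁ W₂)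
    (h₁₃ : Disjoint W₁ W₃) (h₂₃ : Disjoint W₂ W₃) {a b : K →ₗ[ℝ] V} (ha : ∀ x, a x ∈ W₁)
    (hb : ∀ x, b x ∈ W₂) (hab : ∀ x, a x + b x = x) (e : Module.Basis (Fin s ⊕ Fin q) ℝ K)
    (M : Fin s × Fin q → ℝ) : LinearIndependent ℝ (splitVectors a b e M) := by
  have hak : LinearMap.ker a = ⊥ := by
    refine (Submodule.eq_bot_iff _).2 fun x hx => Subtype.ext ?_
    have h := hab x
    rw [LinearMap.mem_ker.1 hx, zero_add] at h
    exact Submodule.disjoint_def.1 h₂₃ _ (h ▸ hb x) (hK x.2)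
  have hbk : LinearMap.ker b = ⊥ := by
    refine (Submodule.eq_bot_iff _).2 fun x hx => Subtype.ext ?_
    have h := hab x
    rw [LinearMap.mem_ker.1 hx, add_zero] at h
    exact Submodule.disjoint_def.1 h₁₃ _ (h ▸ ha x) (hK x.2)
  have hg := linearIndependent_graphVectors e M
  refine (hg.map' a hak).sum_type (hg.map' b hbk) (h₁₂.mono ?_ ?_)
  · rw [Submodule.span_le]
    rintro _ ⟨i, rfl⟩
    exact ha _
  · rw [Submodule.span_le]
    rintro _ ⟨i, rfl⟩
    exact hb _

/-- A graph vector `x` for `M` is `a y + b z` with `y`, `z` in the graph of `N`. Uniqueness of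
components gives `a y = a x`, so `y = x` by injectivity of `a`; a graph determines its matrix. -/
theorem eq_of_span_splitVectors_eq {K : Submodule ℝ V} (hK : K ≤ W₃) (h₁₂ : Disjoint W₁ W₂)
    (h₂₃ : Disjoint W₂ W₃) {a b : K →ₗ[ℝ] V} (ha : ∀ x, a x ∈ W₁)
    (hb : ∀ x, b x ∈ W₂) (hab : ∀ x, a x + b x = x) (e : Module.Basis (Fin s ⊕ Fin q) ℝ K)
    {M N : Fin s × Fin q → ℝ}
    (h : Submodule.span ℝ (range (splitVectors a b e M)) =
      Submodule.span ℝ (range (splitVectors a b e N))) : M = N := by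
  refine eq_of_graphVectors_mem_span e fun i => ?_
  set x := graphVectors e M i with hx
  have hxU : (x : V) ∈ Submodule.span ℝ (range (splitVectors a b e N)) := by
    rw [← h, ← hab]
    exact add_mem (Submodule.subset_span ⟨Sum.inl i, rfl⟩)
      (Submodule.subset_span ⟨Sum.inr i, rfl⟩)
  obtain ⟨c, hc⟩ := (Submodule.mem_span_range_iff_exists_fun ℝ).1 hxU
  rw [Fintype.sum_sum_type] at hc
  set y := ∑ l, c (Sum.inl l) • graphVectors e N l with hy
  set z := ∑ l, c (Sum.inr l) • graphVectors e N l with hz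
  have hcyz : a y + b z = a x + b x := by
    rw [hab, ← hc, hy, hz, map_sum, map_sum]
    simp [splitVectors]
  have hay := (eq_of_add_eq_add_of_disjoint h₁₂ (ha y) (ha x) (hb z) (hb x) hcyz).1
  have hyx : y = x := by
    have h1 : (y : V) - x = b y - b x := by
      rw [← hab y, ← hab x, hay]
      abel
    have h2 : (y : V) - x = 0 := Submodule.disjoint_def.1 h₂₃ _
      (h1 ▸ sub_mem (hb y) (hb x)) (sub_mem (hK y.2) (hK x.2))
    exact Subtype.ext (sub_eq_zero.1 h2)
  rw [← hyx, hy]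
  exact Submodule.sum_mem _ fun l _ => Submodule.smul_mem _ _ (Submodule.subset_span ⟨l, rfl⟩)

/-- Counting dimensions, `U ⊓ W₁` and `U ⊓ W₂` fill `U`, and `U ⊓ W₃` has dimension exactly `s` and
lies in `K`. The components of its vectors remain in `U` and are `2 * s` independent vectors, hence
span `U`. -/
theorem exists_span_splitVectors_eq [FiniteDimensional ℝ V] {K : Submodule ℝ V}
    (hK : K = (W₁ ⊔ W₂) ⊓ W₃) (h₁₂ : Disjoint W₁ W₂)
    (h₁₃ : Disjoint W₁ W₃) (h₂₃ : Disjoint W₂ W₃) {a b : K →ₗ[ℝ] V} (ha : ∀ x, a x ∈ W₁)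
    (hb : ∀ x, b x ∈ W₂) (hab : ∀ x, a x + b x = x) {k : ℕ} (B : Module.Basis (Fin k) ℝ K)
    (hk : k = s + q) {U : Submodule ℝ V} (hU : Module.finrank ℝ U = 2 * s)
    (hU₁ : s ≤ Module.finrank ℝ (U ⊓ W₁ : Submodule ℝ V))
    (hU₂ : s ≤ Module.finrank ℝ (U ⊓ W₂ : Submodule ℝ V))
    (hU₃ : s ≤ Module.finrank ℝ (U ⊓ W₃ : Submodule ℝ V)) :
    ∃ (σ : Fin k ≃ Fin s ⊕ Fin q) (M : Fin s × Fin q → ℝ),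
      Submodule.span ℝ (range (splitVectors a b (B.reindex σ) M)) = U := by
  have hsum : ∀ X Y : Submodule ℝ V, Disjoint X Y →
      Module.finrank ℝ (U ⊓ X ⊔ U ⊓ Y : Submodule ℝ V) =
        Module.finrank ℝ (U ⊓ X : Submodule ℝ V) + Module.finrank ℝ (U ⊓ Y : Submodule ℝ V) ∧
      Module.finrank ℝ (U ⊓ X ⊔ U ⊓ Y : Submodule ℝ V) ≤ 2 * s := fun X Y hXY => by
    have h1 := Submodule.finrank_sup_add_finrank_inf_eq (U ⊓ X) (U ⊓ Y)
    rw [(hXY.mono inf_le_right inf_le_right).eq_bot, finrank_bot, add_zero] at h1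
    exact ⟨h1, hU ▸ Submodule.finrank_mono (sup_le inf_le_left inf_le_left)⟩
  have hU12 : U ⊓ W₁ ⊔ U ⊓ W₂ = U := by
    refine Submodule.eq_of_le_of_finrank_le (sup_le inf_le_left inf_le_left) ?_
    have := (hsum W₁ W₂ h₁₂).1
    omega
  have hU3 : Module.finrank ℝ (U ⊓ W₃ : Submodule ℝ V) = s := by
    have := hsum W₁ W₃ h₁₃
    omega
  have hUK : U ⊓ W₃ ≤ K := by
    rw [hK]
    refine le_inf (inf_le_left.trans ?_) inf_le_right
    conv_lhs => rw [← hU12]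
    exact sup_le_sup inf_le_right inf_le_right
  obtain ⟨σ, M, hM⟩ := exists_graphVectors_mem B hk ((U ⊓ W₃).comap K.subtype)
    ((Submodule.comapSubtypeEquivOfLe hUK).finrank_eq.trans hU3)
  refine ⟨σ, M, Submodule.eq_of_le_of_finrank_le (Submodule.span_le.2 ?_) ?_⟩
  · have hxU : ∀ i, a (graphVectors (B.reindex σ) M i) ∈ U ∧
        b (graphVectors (B.reindex σ) M i) ∈ U := fun i => by
      set x := graphVectors (B.reindex σ) M i with hx
      have hxU : (x : V) ∈ U := (hM i).1
      rw [← hU12] at hxU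
      obtain ⟨y, hy, z, hz, hyz⟩ := Submodule.mem_sup.1 hxU
      obtain ⟨rfl, rfl⟩ := eq_of_add_eq_add_of_disjoint h₁₂ hy.2 (ha x) hz.2 (hb x)
        (hyz.trans (hab x).symm)
      exact ⟨hy.1, hz.1⟩
    rintro _ ⟨i | i, rfl⟩
    · exact (hxU i).1
    · exact (hxU i).2
  · rw [finrank_span_eq_card (linearIndependent_splitVectors (hK ▸ inf_le_right) h₁₂ h₁₃ h₂₃
      ha hb hab _ M), hU]
    simp [two_mul]

end Charts

/-! ### Skewness in terms of cones, and the dimension bound -/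

theorem disjoint_cone_of_skew {m : ℕ} {P Q : AffineSubspace ℝ (EuclideanSpace ℝ (Fin m))}
    (h : Skew P Q) : Disjoint (cone P) (cone Q) := by
  rw [Skew, AffineSubspace.span_union, AffineSubspace.affineSpan_coe,
    AffineSubspace.affineSpan_coe] at h
  have h1 := Submodule.finrank_sup_add_finrank_inf_eq (cone P) (cone Q)
  rw [← cone_sup] at h1
  have h2 := finrank_cone P
  have h3 := finrank_cone Q
  have h4 := finrank_cone (P ⊔ Q)
  have h5 : Module.finrank ℝ (cone P ⊓ cone Q : Submodule ℝ _) = 0 := by omega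
  rw [disjoint_iff, ← Submodule.finrank_eq_zero (R := ℝ), h5]

theorem le_finrank_cone_inf {m : ℕ} {P Q : AffineSubspace ℝ (EuclideanSpace ℝ (Fin m))} {r : ℤ}
    {s : ℕ} (hs : (s : ℤ) = r + 1) (h : r ≤ planeDim (P ⊓ Q)) :
    s ≤ Module.finrank ℝ (cone P ⊓ cone Q : Submodule ℝ _) := by
  have h1 := finrank_cone (P ⊓ Q)
  have h2 := Submodule.finrank_mono (le_inf (cone_mono (inf_le_left (a := P) (b := Q)))
    (cone_mono inf_le_right))
  omega

theorem coveringDimLE_of_subsingleton {X : Type*} [TopologicalSpace X] [Subsingleton X] :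
    CoveringDimLE X 0 := by
  exact HasZeroDimDecomposition.coveringDimLE (n := 0)
    ⟨fun _ => univ, fun x => ⟨0, mem_univ x⟩, fun _ x U _ hx =>
      ⟨univ, isClopen_univ, mem_univ x, fun y _ => Subsingleton.elim x y ▸ hx⟩⟩

theorem corollary3p11 (m : ℕ) (n₁ n₂ n₃ r : ℤ) (hr : -1 ≤ r)
    (P₁ : PlaneSpace m n₁) (P₂ : PlaneSpace m n₂) (P₃ : PlaneSpace m n₃)
    (h₁₂ : Skew P₁.1 P₂.1) (h₁₃ : Skew P₁.1 P₃.1) (h₂₃ : Skew P₂.1 P₃.1)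
    (hspan : affineSpan ℝ ((P₁.1 : Set (EuclideanSpace ℝ (Fin m))) ∪ P₂.1 ∪ P₃.1) = ⊤)
    (hm : (m : ℤ) ≤ n₁ + n₂ + n₃ + 1 - r) :
    CoveringDimLE
      {P : PlaneSpace m (2 * r + 1) //
        r ≤ planeDim (P.1 ⊓ P₁.1) ∧ r ≤ planeDim (P.1 ⊓ P₂.1) ∧ r ≤ planeDim (P.1 ⊓ P₃.1)}
      ((n₁ + n₂ + n₃ + 1 - m - r) * (r + 1)) := by
  set X := {P : PlaneSpace m (2 * r + 1) //
    r ≤ planeDim (P.1 ⊓ P₁.1) ∧ r ≤ planeDim (P.1 ⊓ P₂.1) ∧ r ≤ planeDim (P.1 ⊓ P₃.1)}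
  have hemb : IsEmbedding fun x : X => planeCoord x.1 :=
    (IsEmbedding.mk ⟨rfl⟩ planeCoord_injective).comp IsEmbedding.subtypeVal
  obtain ⟨s, hs⟩ : ∃ s : ℕ, (s : ℤ) = r + 1 := ⟨(r + 1).toNat, by omega⟩
  -- For `r = -1` the only candidate is the empty plane, which the charts at height `1` cannot
  -- reach.
  rcases Nat.eq_zero_or_pos s with rfl | hspos
  · obtain rfl : r = -1 := by omega
    have hbot : ∀ x : X, x.1.1 = ⊥ := fun x => by
      have hx := x.1.2
      rw [planeDim] at hx
      split_ifs at hx with h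
      · exact h
      · omega
    have : Subsingleton X := ⟨fun x y => Subtype.ext (Subtype.ext ((hbot x).trans (hbot y).symm))⟩
    rw [neg_add_cancel, mul_zero]
    exact coveringDimLE_of_subsingleton
  have hd₁₂ := disjoint_cone_of_skew h₁₂
  have hd₁₃ := disjoint_cone_of_skew h₁₃
  have hd₂₃ := disjoint_cone_of_skew h₂₃
  obtain ⟨K, hK⟩ : ∃ K, K = (cone P₁.1 ⊔ cone P₂.1) ⊓ cone P₃.1 := ⟨_, rfl⟩
  have hfin : (Module.finrank ℝ K : ℤ) = n₁ + n₂ + n₃ + 2 - m := by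
    have htop : cone P₁.1 ⊔ cone P₂.1 ⊔ cone P₃.1 = ⊤ := by
      rw [AffineSubspace.span_union, AffineSubspace.span_union, AffineSubspace.affineSpan_coe,
        AffineSubspace.affineSpan_coe, AffineSubspace.affineSpan_coe] at hspan
      rw [← cone_sup, ← cone_sup, hspan, cone_top]
    have h1 := Submodule.finrank_sup_add_finrank_inf_eq (cone P₁.1) (cone P₂.1)
    have h2 := Submodule.finrank_sup_add_finrank_inf_eq (cone P₁.1 ⊔ cone P₂.1) (cone P₃.1)
    rw [hd₁₂.eq_bot, finrank_bot] at h1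
    rw [htop, finrank_top, ← hK, Module.finrank_prod, finrank_euclideanSpace_fin,
      Module.finrank_self] at h2
    have h3 := finrank_cone P₁.1
    have h4 := finrank_cone P₂.1
    have h5 := finrank_cone P₃.1
    rw [P₁.2] at h3
    rw [P₂.2] at h4
    rw [P₃.2] at h5
    omega
  -- The bound `hm` says exactly that `s ≤ dim K`; charts are `s × q` matrices.
  obtain ⟨q, hq⟩ : ∃ q : ℕ, Module.finrank ℝ K = s + q :=
    Nat.exists_eq_add_of_le (by omega)
  have hdim : (n₁ + n₂ + n₃ + 1 - m - r) * (r + 1) = (Fintype.card (Fin s × Fin q) : ℕ) := by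
    rw [Fintype.card_prod, Fintype.card_fin, Fintype.card_fin, Nat.cast_mul, mul_comm, hs,
      show n₁ + n₂ + n₃ + 1 - m - r = q by omega]
  rw [hdim]
  obtain ⟨a, b, ha, hb, hab⟩ := exists_decomposition K (hK ▸ inf_le_left)
  have hKW : K ≤ cone P₃.1 := hK ▸ inf_le_right
  let B := Module.finBasis ℝ K
  have hX1 : TopologicalSpace.MetrizableSpace X := hemb.metrizableSpace
  have hX2 : SecondCountableTopology X := hemb.secondCountableTopology
  let w (σ : Fin (Module.finrank ℝ K) ≃ Fin s ⊕ Fin q) (M : Fin s × Fin q → ℝ) :=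
    splitVectors a b (B.reindex σ) M
  have hwc : ∀ σ i, Continuous fun M => w σ M i := fun σ i => by
    rcases i with i | i <;>
    · simp only [w, splitVectors, Sum.elim_inl, Sum.elim_inr, Function.comp_apply, graphVectors,
        map_add, map_sum, map_smul]
      fun_prop
  have hwl : ∀ σ M, LinearIndependent ℝ (w σ M) := fun σ M =>
    linearIndependent_splitVectors hKW hd₁₂ hd₁₃ hd₂₃ ha hb hab (B.reindex σ) M
  -- A chart is a splitting of the basis of `K` together with a spanning vector required to have
  -- nonzero height.
  refine HasZeroDimDecomposition.coveringDimLE (hasZeroDimDecomposition_of_charts hemb.isInducing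
    (κ := (Fin (Module.finrank ℝ K) ≃ Fin s ⊕ Fin q) × (Fin s ⊕ Fin s))
    (fun p M => sliceCoord (w p.1 M) p.2) (fun p => {M | (w p.1 M p.2).2 ≠ 0})
    (fun p => isOpen_ne_fun (hwc p.1 p.2).snd continuous_const)
    (fun p => continuousOn_sliceCoord (hwc p.1) (hwl p.1) p.2) ?_ ?_)
  · intro p M hM N hN hMN
    exact eq_of_span_splitVectors_eq hKW hd₁₂ hd₂₃ ha hb hab (B.reindex p.1)
      (span_eq_of_sliceCoord_eq hM hN hMN)
  · intro x
    have hU : Module.finrank ℝ (cone x.1.1) = 2 * s := by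
      have h1 := finrank_cone x.1.1
      rw [x.1.2] at h1
      omega
    have hne : (x.1.1 : Set (EuclideanSpace ℝ (Fin m))).Nonempty := by
      rw [AffineSubspace.nonempty_iff_ne_bot]
      intro h
      rw [h, cone_bot, finrank_bot] at hU
      omega
    obtain ⟨σ, M, hσ⟩ := exists_span_splitVectors_eq hK hd₁₂ hd₁₃ hd₂₃ ha hb hab B hq hU
      (le_finrank_cone_inf hs x.2.1) (le_finrank_cone_inf hs x.2.2.1)
      (le_finrank_cone_inf hs x.2.2.2)
    -- Otherwise the cone would lie at height `0`, yet it contains `(p, 1)` for a point `p` of the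
    -- plane.
    obtain ⟨j, hj⟩ : ∃ j, (w σ M j).2 ≠ 0 := by
      by_contra! hall
      obtain ⟨p, hp⟩ := hne
      have hle : Submodule.span ℝ (range (w σ M)) ≤ LinearMap.ker (LinearMap.snd ℝ _ ℝ) := by
        rw [Submodule.span_le]
        rintro _ ⟨j, rfl⟩
        exact hall j
      have h1 := hle (hσ ▸ mk_one_mem_cone hp)
      exact one_ne_zero h1
    exact ⟨(σ, j), M, hj, (planeCoord_eq_sliceCoord hj hσ hne).symm⟩
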